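/- Let $r\ge 0$, $p>0$, let $u\in\mathbb{R}^n$ be a unit vector, let $H=\{x\in\mathbb{R}^n:\langle x,u\rangle=0\}$, and let $K\subset\mathbb{R}^n$ be a compact set with non-empty interior. For $t\in\mathbb{R}$ put $f(t)=\mathrm{vol}_{n-1}\bigl(K\cap(tu+H)\bigr)$. Assume that $f$ is $p$-concave, i.e. $$f\bigl((1-\lambda)s+\lambda t\bigr)\ge\bigl((1-\lambda)f(s)^p+\lambda f(t)^p\bigr)^{1/p}$$ for all $\lambda\in(0,1)$ and all $s,t\in\mathbb{R}$ with $f(s)f(t)>0$. Let $[a,b]$ be the support of $f$ (the closure of $\{t: f(t)>0\}$), put $$\mathrm{g}_r=\frac{\int_a^b t\,f(t)^r\,\mathrm{d}t}{\int_a^b f(t)^r\,\mathrm{d}t},$$ and assume that the point $\mathrm{g}_r\,u$ is the origin. Let $K^-=\{x\in K:\langle x,u\rangle\le 0\}$. If $r\ge 1$, then $$\frac{\mathrm{vol}(K^-)}{\mathrm{vol}(K)}\ge\left(\frac{p+1}{2p+r}\right)^{(p+1)/p},$$ and if $0\le r\le 1$, then $$\frac{\mathrm{vol}(K^-)}{\mathrm{vol}(K)}\ge\left(\frac{p+r}{2p+r}\right)^{(p+1)/p}.$$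 -/

import Mathlib

open MeasureTheory

/-- For `p ≠ 0`, a (nonnegative) function `φ` on a real vector space is `p`-concave if
`φ ((1 - l) x + l y) ≥ ((1 - l) φ(x)^p + l φ(y)^p)^(1/p)` for all `l ∈ (0,1)` and all `x, y`
with `φ(x) φ(y) > 0`. -/
def IsPConcave {E : Type*} [AddCommGroup E] [Module ℝ E] (p : ℝ) (φ : E → ℝ) : Prop :=
  ∀ x y : E, 0 < φ x * φ y → ∀ l : ℝ, 0 < l → l < 1 →
    ((1 - l) * φ x ^ p + l * φ y ^ p) ^ (1 / p) ≤ φ ((1 - l) • x + l • y)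

/-- The hyperplane `H = {x : ⟪x, u⟫ = 0}` through the origin with normal vector `u`. -/
noncomputable abbrev normalHyperplane {n : ℕ} (u : EuclideanSpace ℝ (Fin n)) :
    Submodule ℝ (EuclideanSpace ℝ (Fin n)) :=
  (Submodule.span ℝ {u})ᗮ

/-- The section function `f(t) = vol_{n-1}(K ∩ (t u + H))`. The translated section
`(K - t u) ∩ H` is measured by the Lebesgue measure of the Euclidean space `H`. -/
noncomputable def sectionVolume {n : ℕ} (K : Set (EuclideanSpace ℝ (Fin n)))
    (u : EuclideanSpace ℝ (Fin n)) (t : ℝ) : ℝ :=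
  (volume : Measure (normalHyperplane u)).real
    {y | t • u + (y : EuclideanSpace ℝ (Fin n)) ∈ K}

/-- The number `g_r = (∫_a^b t f(t)^r dt) / (∫_a^b f(t)^r dt)`, where `f` is the section function
of `K` in direction `u` and `[a, b]` is the support of `f`, that is, the closure
of `{t : f(t) ≠ 0}`. -/
noncomputable def poweredCentroid {n : ℕ} (K : Set (EuclideanSpace ℝ (Fin n)))
    (u : EuclideanSpace ℝ (Fin n)) (r : ℝ) : ℝ :=
  (∫ t in tsupport (sectionVolume K u), t * sectionVolume K u t ^ r) /
    ∫ t in tsupport (sectionVolume K u), sectionVolume K u t ^ r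

/-- `K⁻ = {x ∈ K : ⟪x, u⟫ ≤ 0}`. -/
def lowerPart {n : ℕ} (K : Set (EuclideanSpace ℝ (Fin n)))
    (u : EuclideanSpace ℝ (Fin n)) : Set (EuclideanSpace ℝ (Fin n)) :=
  K ∩ {x | inner ℝ x u ≤ 0}

open Set

/-! Normalise the section function to a density `f` on `[a, b]` with distribution function `F`, so
that the volume ratio is `F 0`. Put `q = p / (p + 1)`. Concavity of `f ^ p` makes `f ^ (p + 1) / F`
decreasing (`rpow_mul_cdf_le`) and, by reflection, `f ^ (p + 1) / (1 - F)` increasing. The former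
says that `F ^ q` is concave. The weight `f ^ r` has barycentre `0`, so Jensen bounds `F 0 ^ q`
below by the `f ^ r`-weighted mean of `F ^ q`.

It remains to bound this mean by the constant `c` in question, that is, to show `∫ (F ^ q - c) * f ^
r ≥ 0`. With `α = (r - 1) / (p + 1)`, write `f ^ r` as `(1 - F) ^ α * f` (for `r ≥ 1`) or `F ^ α *
f` (for `r ≤ 1`) times the `α`-th power of the matching quotient. In both cases that power is
increasing, and `F ^ q - c` changes sign once from minus to plus, so a Chebyshev argument removes
the power. Substituting `s = F t` leaves an explicit integral over `[0, 1]`. -/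

/-- `F` is the distribution function on `[a, b]` of a probability density `f` which is positive
on `(a, b)` and whose `p`-th power is concave there. -/
structure IsPConcaveDensity (p a b : ℝ) (f F : ℝ → ℝ) : Prop where
  lt : a < b
  continuousOn : ContinuousOn F (Icc a b)
  hasDerivAt : ∀ t ∈ Ioo a b, HasDerivAt F (f t) t
  pos : ∀ t ∈ Ioo a b, 0 < f t
  concaveOn : ConcaveOn ℝ (Ioo a b) fun t => f t ^ p
  left : F a = 0
  right : F b = 1

/-! ### Monotone quotients of a density and its tails. -/

namespace IsPConcaveDensity

variable {p a b r : ℝ} {f F : ℝ → ℝ}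

theorem strictMonoOn (h : IsPConcaveDensity p a b f F) : StrictMonoOn F (Icc a b) := by
  refine strictMonoOn_of_deriv_pos (convex_Icc a b) h.continuousOn fun t ht => ?_
  rw [interior_Icc] at ht
  rw [(h.hasDerivAt t ht).deriv]
  exact h.pos t ht

theorem cdf_pos (h : IsPConcaveDensity p a b f F) {t : ℝ} (ht : t ∈ Ioo a b) : 0 < F t := by
  rw [← h.left]
  exact h.strictMonoOn (left_mem_Icc.2 h.lt.le) (Ioo_subset_Icc_self ht) ht.1

theorem cdf_lt_one (h : IsPConcaveDensity p a b f F) {t : ℝ} (ht : t ∈ Ioo a b) : F t < 1 := by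
  rw [← h.right]
  exact h.strictMonoOn (Ioo_subset_Icc_self ht) (right_mem_Icc.2 h.lt.le) ht.2

theorem cdf_nonneg (h : IsPConcaveDensity p a b f F) {t : ℝ} (ht : t ∈ Icc a b) : 0 ≤ F t := by
  rw [← h.left]
  exact h.strictMonoOn.monotoneOn (left_mem_Icc.2 h.lt.le) ht ht.1

/-- Exchanges the two tails `F` and `1 - F`. -/
theorem reflect (h : IsPConcaveDensity p a b f F) :
    IsPConcaveDensity p (-b) (-a) (fun t => f (-t)) (fun t => 1 - F (-t)) where
  lt := neg_lt_neg h.lt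
  continuousOn := by
    refine continuousOn_const.sub (h.continuousOn.comp continuousOn_neg fun t ht => ?_)
    exact ⟨by linarith [ht.2], by linarith [ht.1]⟩
  hasDerivAt t ht := by
    have := (h.hasDerivAt (-t) ⟨by linarith [ht.2], by linarith [ht.1]⟩).comp t (hasDerivAt_neg t)
    simpa using this.const_sub 1
  pos t ht := h.pos (-t) ⟨by linarith [ht.2], by linarith [ht.1]⟩
  concaveOn := by
    refine ⟨convex_Ioo _ _, fun x hx y hy s t hs ht hst => ?_⟩
    have := h.concaveOn.2 (x := -x) (y := -y) ⟨by linarith [hx.2], by linarith [hx.1]⟩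
      ⟨by linarith [hy.2], by linarith [hy.1]⟩ hs ht hst
    simp only [smul_eq_mul] at this ⊢
    convert this using 3
    ring
  left := by simp [h.right]
  right := by simp [h.left]

/-- If `f s < f t`, an affine map of slope `l = (f t / f s) ^ p` carries `s` to `t`. By concavity of
`f ^ p`, the density at the image of `x < s` is at least `ρ = f t / f s` times that at `x`.
Integrating, the mass below `t` is at least `l * ρ = ρ ^ (p + 1)` times the mass below `s`. -/
theorem rpow_mul_cdf_le (h : IsPConcaveDensity p a b f F) (hp : 0 < p) {s t : ℝ}
    (hs : s ∈ Ioo a b) (ht : t ∈ Ioo a b) (hst : s < t) :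
    f t ^ (p + 1) * F s ≤ f s ^ (p + 1) * F t := by
  have hfs := h.pos s hs
  have hft := h.pos t ht
  have hFst : F s ≤ F t :=
    h.strictMonoOn.monotoneOn (Ioo_subset_Icc_self hs) (Ioo_subset_Icc_self ht) hst.le
  rcases le_total (f t) (f s) with hle | hle
  · exact mul_le_mul (Real.rpow_le_rpow hft.le hle (by linarith)) hFst
      (h.cdf_pos hs).le (Real.rpow_nonneg hfs.le _)
  obtain ⟨ρ, hρ⟩ : ∃ ρ, ρ = f t / f s := ⟨_, rfl⟩
  have hρ1 : 1 ≤ ρ := by rw [hρ, le_div_iff₀ hfs]; linarith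
  have hρ0 : 0 < ρ := by linarith
  have hftρ : f t = ρ * f s := by rw [hρ]; field_simp
  obtain ⟨l, hl⟩ : ∃ l, l = ρ ^ p := ⟨_, rfl⟩
  have hl1 : 1 ≤ l := by rw [hl]; exact Real.one_le_rpow hρ1 hp.le
  have hl0 : 0 < l := by linarith
  have hpt : f t ^ p = l * f s ^ p := by rw [hftρ, Real.mul_rpow hρ0.le hfs.le, hl]
  have hA : 0 < f s ^ p := Real.rpow_pos_of_pos hfs p
  have hsub : ∀ x ∈ Ioo a s, x ∈ Ioo a b := fun x hx => ⟨hx.1, hx.2.trans hs.2⟩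
  have hy1 : ∀ x ∈ Ioo a s, x ≤ t - l * (s - x) := by
    intro x hx
    -- Comparing the chords over `[x, s]` and `[s, t]` and dropping `f x ^ p ≥ 0` shows that the
    -- affine map moves no point to the left; in particular its images stay in `[a, b]`.
    have h1 := h.concaveOn.slope_anti_adjacent (hsub x hx) ht hx.2 hst
    have hx0 : 0 < f x ^ p := Real.rpow_pos_of_pos (h.pos x (hsub x hx)) p
    rw [div_le_div_iff₀ (by linarith) (by linarith [hx.2]), hpt] at h1
    have : l * f s ^ p * (s - x) ≤ f s ^ p * (t - x) := by
      have := mul_nonneg hx0.le (sub_nonneg.2 hst.le)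
      linarith
    have : l * (s - x) ≤ t - x := by
      by_contra hcon
      push Not at hcon
      have := mul_lt_mul_of_pos_left hcon hA
      linarith
    linarith
  have hya : a ≤ t - l * (s - a) := by
    have := le_on_closure (s := Ioo a s) (f := fun x => x) (g := fun x => t - l * (s - x)) hy1
      (by fun_prop) (by fun_prop) (x := a) (by
        rw [closure_Ioo hs.1.ne]; exact left_mem_Icc.2 hs.1.le)
    exact this
  have hyIoo : ∀ x ∈ Ioo a s, t - l * (s - x) ∈ Ioo a t := fun x hx =>
    ⟨hx.1.trans_le (hy1 x hx), by nlinarith [hx.2]⟩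
  have hyf : ∀ x ∈ Ioo a s, ρ * f x ≤ f (t - l * (s - x)) := by
    intro x hx
    have hyx := hyIoo x hx
    have hyb : t - l * (s - x) ∈ Ioo a b := ⟨hyx.1, hyx.2.trans ht.2⟩
    have h0 : 0 < s - x := sub_pos.2 hx.2
    -- Both chord slopes are compared with the slope of the chord from `x` to `t`.
    have h1 : (f t ^ p - f (t - l * (s - x)) ^ p) / (t - (t - l * (s - x))) ≤
        (f s ^ p - f x ^ p) / (s - x) := by
      have e1 := h.concaveOn.slope_anti (hsub x hx) (x := x)
        (show s ∈ Ioo a b \ {x} from ⟨hs, hx.2.ne'⟩)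
        (show t ∈ Ioo a b \ {x} from ⟨ht, (hx.2.trans hst).ne'⟩) hst.le
      have e2 := h.concaveOn.slope_anti ht (x := t)
        (show x ∈ Ioo a b \ {t} from ⟨hsub x hx, (hx.2.trans hst).ne⟩)
        (show t - l * (s - x) ∈ Ioo a b \ {t} from ⟨hyb, hyx.2.ne⟩) (hy1 x hx)
      rw [slope_comm _ t x] at e2
      have e3 := e2.trans e1
      rw [slope_comm, slope_def_field, slope_def_field] at e3
      exact e3
    rw [show t - (t - l * (s - x)) = l * (s - x) by ring,
      div_le_div_iff₀ (by positivity) h0] at h1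
    have h2 : f t ^ p - f (t - l * (s - x)) ^ p ≤ l * (f s ^ p - f x ^ p) := by
      by_contra hcon
      push Not at hcon
      have := mul_lt_mul_of_pos_right hcon h0
      linarith
    rw [hpt] at h2
    have h3 : (ρ * f x) ^ p ≤ f (t - l * (s - x)) ^ p := by
      rw [Real.mul_rpow hρ0.le (h.pos x (hsub x hx)).le, ← hl]
      linarith
    exact (Real.rpow_le_rpow_iff (mul_nonneg hρ0.le (h.pos x (hsub x hx)).le)
      (h.pos _ hyb).le hp).1 h3
  have hmono : MonotoneOn (fun x => F (t - l * (s - x)) - l * ρ * F x) (Icc a s) := by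
    have hd : ∀ x ∈ Ioo a s, HasDerivAt (fun x => F (t - l * (s - x)) - l * ρ * F x)
        (f (t - l * (s - x)) * l - l * ρ * f x) x := by
      intro x hx
      have hyx := hyIoo x hx
      have hin : HasDerivAt (fun x => t - l * (s - x)) l x := by
        simpa using (((hasDerivAt_id x).const_sub s).const_mul l).const_sub t
      exact ((h.hasDerivAt _ ⟨hyx.1, hyx.2.trans ht.2⟩).comp x hin).sub
        ((h.hasDerivAt x (hsub x hx)).const_mul _)
    refine monotoneOn_of_deriv_nonneg (convex_Icc a s) ?_ ?_ ?_
    · refine ContinuousOn.sub (h.continuousOn.comp (by fun_prop) fun x hx => ⟨?_, ?_⟩)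
        (continuousOn_const.mul (h.continuousOn.mono fun x hx => ⟨hx.1, hx.2.trans hs.2.le⟩))
      · nlinarith [hx.1]
      · nlinarith [hx.2, ht.2]
    · rw [interior_Icc]
      exact fun x hx => (hd x hx).differentiableAt.differentiableWithinAt
    · rw [interior_Icc]
      intro x hx
      rw [(hd x hx).deriv]
      nlinarith [hyf x hx]
  have hfin := hmono (left_mem_Icc.2 hs.1.le) (right_mem_Icc.2 hs.1.le) hs.1.le
  simp only [h.left, mul_zero, sub_zero, sub_self] at hfin
  have h0 : 0 ≤ F (t - l * (s - a)) :=
    h.cdf_nonneg ⟨hya, by nlinarith [mul_nonneg hl0.le (sub_nonneg.2 hs.1.le), ht.2]⟩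
  have h4 : f t ^ (p + 1) = f s ^ (p + 1) * (l * ρ) := by
    rw [hftρ, Real.mul_rpow hρ0.le hfs.le, Real.rpow_add_one hρ0.ne', hl]
    ring
  rw [h4, mul_assoc]
  exact mul_le_mul_of_nonneg_left (by linarith) (Real.rpow_nonneg hfs.le _)

theorem antitoneOn_rpow_div_cdf (h : IsPConcaveDensity p a b f F) (hp : 0 < p) :
    AntitoneOn (fun t => f t ^ (p + 1) / F t) (Ioo a b) := by
  intro s hs t ht hst
  rcases hst.eq_or_lt with rfl | hst
  · exact le_rfl
  exact (div_le_div_iff₀ (h.cdf_pos ht) (h.cdf_pos hs)).2 (h.rpow_mul_cdf_le hp hs ht hst)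

theorem monotoneOn_rpow_div_one_sub_cdf (h : IsPConcaveDensity p a b f F) (hp : 0 < p) :
    MonotoneOn (fun t => f t ^ (p + 1) / (1 - F t)) (Ioo a b) := by
  intro s hs t ht hst
  have := h.reflect.antitoneOn_rpow_div_cdf hp
    (show -t ∈ Ioo (-b) (-a) from ⟨neg_lt_neg ht.2, neg_lt_neg ht.1⟩)
    (show -s ∈ Ioo (-b) (-a) from ⟨neg_lt_neg hs.2, neg_lt_neg hs.1⟩) (neg_le_neg hst)
  simpa using this

/-- The derivative is `q * (f ^ (p + 1) / F) ^ (1 / (p + 1))` with `q = p / (p + 1)`, a decreasing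
function. -/
theorem concaveOn_cdf_rpow (h : IsPConcaveDensity p a b f F) (hp : 0 < p) :
    ConcaveOn ℝ (Icc a b) fun t => F t ^ (p / (p + 1)) := by
  have hd : ∀ t ∈ Ioo a b, HasDerivAt (fun t => F t ^ (p / (p + 1)))
      (f t * (p / (p + 1)) * F t ^ (p / (p + 1) - 1)) t := fun t ht =>
    (h.hasDerivAt t ht).rpow_const (Or.inl (h.cdf_pos ht).ne')
  refine AntitoneOn.concaveOn_of_deriv (convex_Icc a b)
    (h.continuousOn.rpow_const fun _ _ => Or.inr (by positivity)) ?_ ?_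
  · rw [interior_Icc]
    exact fun t ht => (hd t ht).differentiableAt.differentiableWithinAt
  · rw [interior_Icc]
    have key : ∀ t ∈ Ioo a b, deriv (fun t => F t ^ (p / (p + 1))) t =
        p / (p + 1) * (f t ^ (p + 1) / F t) ^ (1 / (p + 1)) := by
      intro t ht
      rw [(hd t ht).deriv, Real.div_rpow (Real.rpow_nonneg (h.pos t ht).le _) (h.cdf_pos ht).le,
        ← Real.rpow_mul (h.pos t ht).le, mul_one_div_cancel (by linarith), Real.rpow_one,
        show p / (p + 1) - 1 = -(1 / (p + 1)) by field_simp; ring,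
        Real.rpow_neg (h.cdf_pos ht).le]
      ring
    intro s hs t ht hst
    rw [key s hs, key t ht]
    refine mul_le_mul_of_nonneg_left (Real.rpow_le_rpow ?_
      (h.antitoneOn_rpow_div_cdf hp hs ht hst) (by positivity)) (by positivity)
    exact div_nonneg (Real.rpow_nonneg (h.pos t ht).le _) (h.cdf_pos ht).le

end IsPConcaveDensity

/-! ### Chebyshev, Beta-type and Jensen inequalities for integrals. -/

/-- A Chebyshev-type inequality: if `φ` has the sign of `m - k`, then `∫ φ * m ≥ k * ∫ φ`. -/
theorem integral_mul_nonneg_of_sign {a b k : ℝ} (hab : a ≤ b) {φ m : ℝ → ℝ}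
    (hφ : IntervalIntegrable φ volume a b)
    (hφm : IntervalIntegrable (fun t => φ t * m t) volume a b)
    (hsign : ∀ t ∈ Ioo a b, 0 ≤ φ t * (m t - k))
    (hk : 0 ≤ (∫ t in a..b, φ t) * k) : 0 ≤ ∫ t in a..b, φ t * m t := by
  refine hk.trans ?_
  rw [← intervalIntegral.integral_mul_const]
  refine intervalIntegral.integral_mono_on_of_le_Ioo hab (hφ.mul_const _) hφm fun t ht => ?_
  linarith [hsign t ht]

/-- The function `s ^ q * (1 - s) ^ (α + 1)` vanishes at both ends. Integrating its derivative turns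
the claim into `∫ (q * s ^ (q - 1) - 1) * (1 - s) ^ α ≥ 0`, where the first factor is decreasing
with mean zero and the second is decreasing. -/
theorem integral_rpow_sub_mul_one_sub_rpow_nonneg {q α : ℝ} (hq0 : 0 < q) (hq1 : q < 1)
    (hα : 0 ≤ α) : 0 ≤ ∫ s in (0 : ℝ)..1, (s ^ q - 1 / (q + 1 + α)) * (1 - s) ^ α := by
  have hc : 0 < q + 1 + α := by linarith
  have hi1 : IntervalIntegrable (fun s : ℝ => s ^ (q - 1)) volume 0 1 :=
    intervalIntegral.intervalIntegrable_rpow' (by linarith)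
  have hcont : Continuous fun s : ℝ => (1 - s) ^ α :=
    (continuous_const.sub continuous_id).rpow_const fun _ => Or.inr hα
  have hi2 : IntervalIntegrable (fun s : ℝ => q * s ^ (q - 1) - 1) volume 0 1 :=
    (hi1.const_mul q).sub intervalIntegrable_const
  have hi3 : IntervalIntegrable (fun s : ℝ => (q * s ^ (q - 1) - 1) * (1 - s) ^ α) volume 0 1 :=
    hi2.mul_continuousOn hcont.continuousOn
  have hcont4 : Continuous fun s : ℝ => (s ^ q - 1 / (q + 1 + α)) * (1 - s) ^ α :=
    ((Real.continuous_rpow_const hq0.le).sub continuous_const).mul hcont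
  have hi4 := hcont4.intervalIntegrable 0 1 (μ := volume)
  have hsum0 : ∫ s in (0 : ℝ)..1, (q * s ^ (q - 1) - 1) = 0 := by
    rw [intervalIntegral.integral_sub (hi1.const_mul q) intervalIntegrable_const,
      intervalIntegral.integral_const_mul, integral_rpow (Or.inl (by linarith))]
    simp [hq0.ne']
  have hmain : 0 ≤ ∫ s in (0 : ℝ)..1, (q * s ^ (q - 1) - 1) * (1 - s) ^ α := by
    have hq1' : 0 < 1 - q := by linarith
    -- The zero of `q * s ^ (q - 1) - 1`, where its sign changes.
    obtain ⟨t, ht⟩ : ∃ t, t = q ^ (1 / (1 - q)) := ⟨_, rfl⟩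
    have ht0 : 0 < t := ht ▸ Real.rpow_pos_of_pos hq0 _
    have ht1 : t ≤ 1 := ht ▸ Real.rpow_le_one hq0.le hq1.le (by positivity)
    have hteq : q * t ^ (q - 1) = 1 := by
      rw [ht, ← Real.rpow_mul hq0.le, show 1 / (1 - q) * (q - 1) = -1 by field_simp; ring,
        Real.rpow_neg_one, mul_inv_cancel₀ hq0.ne']
    refine integral_mul_nonneg_of_sign zero_le_one hi2 hi3 (k := (1 - t) ^ α) (fun s hs => ?_)
      (by rw [hsum0, zero_mul])
    rcases le_total s t with hst | hst
    · have h1 : t ^ (q - 1) ≤ s ^ (q - 1) :=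
        Real.rpow_le_rpow_of_nonpos hs.1 hst (by linarith)
      have h2 : (1 - t) ^ α ≤ (1 - s) ^ α :=
        Real.rpow_le_rpow (by linarith) (by linarith) hα
      refine mul_nonneg ?_ (by linarith)
      have := mul_le_mul_of_nonneg_left h1 hq0.le
      linarith
    · have h1 : s ^ (q - 1) ≤ t ^ (q - 1) :=
        Real.rpow_le_rpow_of_nonpos ht0 hst (by linarith)
      have h2 : (1 - s) ^ α ≤ (1 - t) ^ α :=
        Real.rpow_le_rpow (by linarith [hs.2]) (by linarith) hα
      refine mul_nonneg_of_nonpos_of_nonpos ?_ (by linarith)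
      have := mul_le_mul_of_nonneg_left h1 hq0.le
      linarith
  have hexact : ∫ s in (0 : ℝ)..1, ((q * s ^ (q - 1) - 1) * (1 - s) ^ α -
      (q + 1 + α) * ((s ^ q - 1 / (q + 1 + α)) * (1 - s) ^ α)) = 0 := by
    rw [intervalIntegral.integral_eq_sub_of_hasDerivAt_of_le zero_le_one
      (f := fun s => s ^ q * (1 - s) ^ (α + 1)) ?_ ?_ (hi3.sub (hi4.const_mul _))]
    · simp [hq0.ne', show α + 1 ≠ 0 by linarith]
    · exact ((Real.continuous_rpow_const hq0.le).mul
        ((continuous_const.sub continuous_id).rpow_const fun _ =>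
          Or.inr (by linarith))).continuousOn
    · intro s hs
      have hs0 : s ≠ 0 := hs.1.ne'
      have h1s : 0 < 1 - s := by linarith [hs.2]
      have h1 := Real.hasDerivAt_rpow_const (x := s) (p := q) (Or.inl hs.1.ne')
      have h2 := ((hasDerivAt_id s).const_sub 1).rpow_const (p := α + 1) (Or.inl h1s.ne')
      refine (h1.mul h2).congr_deriv ?_
      simp only [id]
      rw [add_sub_cancel_right, Real.rpow_add_one h1s.ne', Real.rpow_sub_one hs.1.ne']
      field_simp
      ring
  rw [intervalIntegral.integral_sub hi3 (hi4.const_mul _),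
    intervalIntegral.integral_const_mul] at hexact
  exact nonneg_of_mul_nonneg_right (by linarith) hc

/-- Jensen for the measure with density `w`, whose barycentre is `0`. -/
theorem ConcaveOn.le_of_weighted_integral {a b c : ℝ} {G w : ℝ → ℝ}
    (hG : ConcaveOn ℝ (Icc a b) G) (hGc : ContinuousOn G (Icc a b)) (hab : a ≤ b)
    (hw : Measurable w) (hw0 : ∀ t, 0 ≤ w t) (hwi : IntervalIntegrable w volume a b)
    (hwpos : 0 < ∫ t in a..b, w t) (hmean : ∫ t in a..b, t * w t = 0)
    (hint : 0 ≤ ∫ t in a..b, (G t - c) * w t) : c ≤ G 0 := by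
  have hwi' : IntegrableOn w (Ioc a b) := (intervalIntegrable_iff_integrableOn_Ioc_of_le hab).1 hwi
  obtain ⟨μ, hμ⟩ : ∃ μ, μ = (volume.restrict (Ioc a b)).withDensity fun t => ENNReal.ofReal (w t) :=
    ⟨_, rfl⟩
  have hint_eq : ∀ g : ℝ → ℝ, ∫ t, g t ∂μ = ∫ t in a..b, g t * w t := by
    intro g
    rw [hμ, integral_withDensity_eq_integral_toReal_smul hw.ennreal_ofReal (by simp),
      intervalIntegral.integral_of_le hab]
    refine integral_congr_ae (Filter.Eventually.of_forall fun t => ?_)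
    simp [ENNReal.toReal_ofReal (hw0 t), mul_comm]
  have hfin : IsFiniteMeasure μ := hμ ▸ isFiniteMeasure_withDensity_ofReal hwi'.2
  have hmass : 0 < μ.real univ := by
    have := hint_eq fun _ => 1
    simp only [integral_const, smul_eq_mul, mul_one, one_mul] at this
    rwa [this]
  have hne : NeZero μ := ⟨by rintro h; simp [h] at hmass⟩
  have hmem : ∀ᵐ t ∂μ, t ∈ Icc a b := by
    rw [hμ]
    refine (withDensity_absolutelyContinuous _ _).ae_le ?_
    exact (ae_restrict_mem measurableSet_Ioc).mono fun t ht => Ioc_subset_Icc_self ht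
  have hrestr : μ.restrict (Icc a b) = μ := Measure.restrict_eq_self_of_ae_mem hmem
  have hintble : ∀ g : ℝ → ℝ, ContinuousOn g (Icc a b) → Integrable g μ := fun g hg => by
    rw [← hrestr]
    exact hg.integrableOn_compact isCompact_Icc
  have hJ := hG.le_map_average hGc isClosed_Icc hmem (hintble _ continuousOn_id) (hintble _ hGc)
  rw [average_eq, average_eq, hint_eq, hint_eq, hmean, smul_zero, smul_eq_mul] at hJ
  refine le_trans ?_ hJ
  have hone : μ.real univ = ∫ t in a..b, w t := by
    have := hint_eq fun _ => 1
    simpa only [integral_const, smul_eq_mul, mul_one, one_mul] using this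
  rw [hone, inv_mul_eq_div, le_div_iff₀ hwpos]
  have hGw : IntervalIntegrable (fun t => G t * w t) volume a b :=
    hwi.continuousOn_mul (by rwa [uIcc_of_le hab])
  simp only [sub_mul] at hint
  rw [intervalIntegral.integral_sub hGw (hwi.const_mul c),
    intervalIntegral.integral_const_mul] at hint
  linarith

/-! ### The weighted mean of the power of the distribution function. -/

namespace IsPConcaveDensity

variable {p a b r : ℝ} {f F : ℝ → ℝ}

theorem intervalIntegrable (h : IsPConcaveDensity p a b f F) : IntervalIntegrable f volume a b :=
  (intervalIntegrable_iff_integrableOn_Ioc_of_le h.lt.le).2 <|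
    intervalIntegral.integrableOn_deriv_of_nonneg h.continuousOn h.hasDerivAt
      fun t ht => (h.pos t ht).le

theorem exists_cdf_rpow_eq (h : IsPConcaveDensity p a b f F) {q c : ℝ} (hq : 0 < q)
    (hc0 : 0 < c) (hc1 : c < 1) : ∃ t ∈ Ioo a b, F t ^ q = c := by
  have hcont : ContinuousOn (fun t => F t ^ q) (Icc a b) :=
    h.continuousOn.rpow_const fun _ _ => Or.inr hq.le
  have := intermediate_value_Ioo h.lt.le hcont (show c ∈ Ioo (F a ^ q) (F b ^ q) by
    rw [h.left, h.right, Real.zero_rpow hq.ne', Real.one_rpow]; exact ⟨hc0, hc1⟩)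
  exact this

/-- `F ^ q - c` changes sign only at the point `t₀` where `F ^ q = c`. Since `m` increases,
replacing `m` by the constant `m t₀` can only lower the integral. -/
theorem integral_cdf_rpow_sub_mul_nonneg (h : IsPConcaveDensity p a b f F) {q c : ℝ} (hq : 0 < q)
    (hc0 : 0 < c) (hc1 : c < 1) {w m : ℝ → ℝ} (hw : ∀ t ∈ Ioo a b, 0 ≤ w t)
    (hm : MonotoneOn m (Ioo a b)) (hm0 : ∀ t ∈ Ioo a b, 0 ≤ m t)
    (hwi : IntervalIntegrable (fun t => (F t ^ q - c) * w t) volume a b)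
    (hwm : ∀ t ∈ Ioo a b, w t * m t = f t ^ r)
    (hfr : IntervalIntegrable (fun t => f t ^ r) volume a b)
    (hint : 0 ≤ ∫ t in a..b, (F t ^ q - c) * w t) :
    0 ≤ ∫ t in a..b, (F t ^ q - c) * f t ^ r := by
  obtain ⟨t₀, ht₀, hct⟩ := h.exists_cdf_rpow_eq hq hc0 hc1
  have hcont : ContinuousOn (fun t => F t ^ q - c) (uIcc a b) := by
    rw [uIcc_of_le h.lt.le]
    exact (h.continuousOn.rpow_const fun _ _ => Or.inr hq.le).sub continuousOn_const
  have heq : EqOn (fun t => (F t ^ q - c) * w t * m t) (fun t => (F t ^ q - c) * f t ^ r)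
      (Ioo a b) := fun t ht => by
    simp only [mul_assoc, hwm t ht]
  have hae : ∀ᵐ t, t ∈ uIoc a b → (F t ^ q - c) * w t * m t = (F t ^ q - c) * f t ^ r := by
    filter_upwards [compl_mem_ae_iff.2 (measure_singleton b)] with t htb ht
    rw [uIoc_of_le h.lt.le] at ht
    exact heq ⟨ht.1, lt_of_le_of_ne ht.2 htb⟩
  rw [← intervalIntegral.integral_congr_ae hae]
  refine integral_mul_nonneg_of_sign h.lt.le hwi ?_ (k := m t₀) (fun t ht => ?_)
    (mul_nonneg hint (hm0 t₀ ht₀))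
  · refine (hfr.continuousOn_mul hcont).congr_ae ?_
    refine Filter.EventuallyEq.symm ?_
    rw [Filter.EventuallyEq, ae_restrict_iff' measurableSet_uIoc]
    exact hae
  · rcases le_total t t₀ with htt | htt
    · have h1 : F t ^ q ≤ F t₀ ^ q := Real.rpow_le_rpow (h.cdf_pos ht).le
        (h.strictMonoOn.monotoneOn (Ioo_subset_Icc_self ht) (Ioo_subset_Icc_self ht₀) htt) hq.le
      exact mul_nonneg_of_nonpos_of_nonpos
        (mul_nonpos_of_nonpos_of_nonneg (by linarith) (hw t ht)) (by linarith [hm ht ht₀ htt])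
    · have h1 : F t₀ ^ q ≤ F t ^ q := Real.rpow_le_rpow (h.cdf_pos ht₀).le
        (h.strictMonoOn.monotoneOn (Ioo_subset_Icc_self ht₀) (Ioo_subset_Icc_self ht) htt) hq.le
      exact mul_nonneg (mul_nonneg (by linarith) (hw t ht)) (by linarith [hm ht₀ ht htt])

theorem integral_nonneg_of_one_le (h : IsPConcaveDensity p a b f F) (hp : 0 < p) (hr : 1 ≤ r)
    (hfr : IntervalIntegrable (fun t => f t ^ r) volume a b) :
    0 ≤ ∫ t in a..b, (F t ^ (p / (p + 1)) - (p + 1) / (2 * p + r)) * f t ^ r := by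
  obtain ⟨α, hα⟩ : ∃ α, α = (r - 1) / (p + 1) := ⟨_, rfl⟩
  obtain ⟨q, hq⟩ : ∃ q, q = p / (p + 1) := ⟨_, rfl⟩
  have hα0 : 0 ≤ α := hα ▸ div_nonneg (by linarith) (by linarith)
  have hq0 : 0 < q := hq ▸ by positivity
  have hq1 : q < 1 := by rw [hq, div_lt_one (by linarith)]; linarith
  have hc : (p + 1) / (2 * p + r) = 1 / (q + 1 + α) := by
    have : q + 1 + α = (2 * p + r) / (p + 1) := by rw [hq, hα]; field_simp; ring
    rw [this, one_div_div]
  have hcont : Continuous fun s : ℝ => (s ^ q - 1 / (q + 1 + α)) * (1 - s) ^ α :=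
    ((Real.continuous_rpow_const hq0.le).sub continuous_const).mul
      ((continuous_const.sub continuous_id).rpow_const fun _ => Or.inr hα0)
  have hwi : IntervalIntegrable
      (fun t => (F t ^ q - 1 / (q + 1 + α)) * (1 - F t) ^ α * f t) volume a b :=
    h.intervalIntegrable.continuousOn_mul (by
      rw [uIcc_of_le h.lt.le]
      exact hcont.comp_continuousOn h.continuousOn)
  -- The substitution `s = F t`.
  have hsubst : ∫ t in a..b, (F t ^ q - 1 / (q + 1 + α)) * (1 - F t) ^ α * f t =
      ∫ s in (0 : ℝ)..1, (s ^ q - 1 / (q + 1 + α)) * (1 - s) ^ α := by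
    have hcontF : ContinuousOn F (uIcc a b) := by
      rw [uIcc_of_le h.lt.le]
      exact h.continuousOn
    have := intervalIntegral.integral_comp_mul_deriv''' (f' := f) hcontF
      (fun t ht => ?_) hcont.continuousOn ?_ ?_
    · rwa [h.left, h.right] at this
    · rw [min_eq_left h.lt.le, max_eq_right h.lt.le] at ht
      exact (h.hasDerivAt t ht).hasDerivWithinAt
    · refine hcont.continuousOn.integrableOn_compact (isCompact_uIcc.image_of_continuousOn hcontF)
    · rw [uIcc_of_le h.lt.le, integrableOn_Icc_iff_integrableOn_Ioc]
      exact (intervalIntegrable_iff_integrableOn_Ioc_of_le h.lt.le).1 hwi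
  rw [← hq, hc]
  simp only [mul_assoc] at hwi hsubst
  refine h.integral_cdf_rpow_sub_mul_nonneg (w := fun t => (1 - F t) ^ α * f t)
    (m := fun t => (f t ^ (p + 1) / (1 - F t)) ^ α) hq0 (by positivity)
    ((div_lt_one (by positivity)).2 (by linarith)) (fun t ht => ?_) ?_ (fun t ht => ?_) hwi
    (fun t ht => ?_) hfr ?_
  · exact mul_nonneg (Real.rpow_nonneg (by linarith [h.cdf_lt_one ht]) _) (h.pos t ht).le
  · intro s hs t ht hst
    refine Real.rpow_le_rpow ?_ (h.monotoneOn_rpow_div_one_sub_cdf hp hs ht hst) hα0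
    exact div_nonneg (Real.rpow_nonneg (h.pos s hs).le _) (by linarith [h.cdf_lt_one hs])
  · exact Real.rpow_nonneg (div_nonneg (Real.rpow_nonneg (h.pos t ht).le _)
      (by linarith [h.cdf_lt_one ht])) _
  · have h1 : 0 < 1 - F t := by linarith [h.cdf_lt_one ht]
    have hf := h.pos t ht
    rw [Real.div_rpow (Real.rpow_nonneg hf.le _) h1.le, ← Real.rpow_mul hf.le,
      show (p + 1) * α = r - 1 by rw [hα]; field_simp, Real.rpow_sub_one hf.ne']
    have := (Real.rpow_pos_of_pos h1 α).ne'
    field_simp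
  · rw [hsubst]
    exact integral_rpow_sub_mul_one_sub_rpow_nonneg hq0 hq1 hα0

theorem integral_nonneg_of_le_one (h : IsPConcaveDensity p a b f F) (hp : 0 < p) (hr : 0 ≤ r)
    (hr1 : r ≤ 1) (hfr : IntervalIntegrable (fun t => f t ^ r) volume a b) :
    0 ≤ ∫ t in a..b, (F t ^ (p / (p + 1)) - (p + r) / (2 * p + r)) * f t ^ r := by
  obtain ⟨α, hα⟩ : ∃ α, α = (r - 1) / (p + 1) := ⟨_, rfl⟩
  obtain ⟨q, hq⟩ : ∃ q, q = p / (p + 1) := ⟨_, rfl⟩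
  have hα0 : α ≤ 0 := hα ▸ div_nonpos_of_nonpos_of_nonneg (by linarith) (by linarith)
  have hα1 : 0 < α + 1 := by
    have : α + 1 = (p + r) / (p + 1) := by rw [hα]; field_simp; ring
    rw [this]; positivity
  have hq0 : 0 < q := hq ▸ by positivity
  have hc : (p + r) / (2 * p + r) = (α + 1) / (q + α + 1) := by
    have e1 : α + 1 = (p + r) / (p + 1) := by rw [hα]; field_simp; ring
    have e2 : q + α + 1 = (2 * p + r) / (p + 1) := by rw [hq, hα]; field_simp; ring
    rw [e1, e2, div_div_div_cancel_right₀ (by linarith)]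
  -- For `β < 1` the factor `F ^ (β - 1)` blows up at `a`. Integrability comes from the continuous
  -- primitive `F ^ β / β` having a nonnegative derivative.
  have hderiv : ∀ β, 0 < β → ContinuousOn (fun t => F t ^ β / β) (Icc a b) ∧
      (∀ t ∈ Ioo a b, HasDerivAt (fun t => F t ^ β / β) (F t ^ (β - 1) * f t) t) ∧
      IntervalIntegrable (fun t => F t ^ (β - 1) * f t) volume a b ∧
      ∫ t in a..b, F t ^ (β - 1) * f t = 1 / β := by
    intro β hβ
    have h1 : ContinuousOn (fun t => F t ^ β / β) (Icc a b) :=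
      (h.continuousOn.rpow_const fun _ _ => Or.inr hβ.le).div_const β
    have h2 : ∀ t ∈ Ioo a b, HasDerivAt (fun t => F t ^ β / β) (F t ^ (β - 1) * f t) t := by
      intro t ht
      refine (((h.hasDerivAt t ht).rpow_const (p := β)
        (Or.inl (h.cdf_pos ht).ne')).div_const β).congr_deriv ?_
      field_simp
    have h3 : IntervalIntegrable (fun t => F t ^ (β - 1) * f t) volume a b :=
      (intervalIntegrable_iff_integrableOn_Ioc_of_le h.lt.le).2 <|
        intervalIntegral.integrableOn_deriv_of_nonneg h1 h2
          fun t ht => mul_nonneg (Real.rpow_nonneg (h.cdf_pos ht).le _) (h.pos t ht).le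
    refine ⟨h1, h2, h3, ?_⟩
    rw [intervalIntegral.integral_eq_sub_of_hasDerivAt_of_le h.lt.le h1 h2 h3, h.left, h.right,
      Real.zero_rpow hβ.ne', Real.one_rpow]
    simp
  obtain ⟨-, -, hi1, he1⟩ := hderiv (α + 1) hα1
  obtain ⟨-, -, hi2, he2⟩ := hderiv (q + α + 1) (by linarith)
  rw [add_sub_cancel_right] at he1 he2
  simp only [add_sub_cancel_right] at hi1 hi2
  have hae : EqOn (fun t => F t ^ (q + α) * f t - (α + 1) / (q + α + 1) * (F t ^ α * f t))
      (fun t => (F t ^ q - (α + 1) / (q + α + 1)) * (F t ^ α * f t)) (uIoc a b) := by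
    intro t ht
    rw [uIoc_of_le h.lt.le] at ht
    have : 0 < F t := by
      rw [← h.left]
      exact h.strictMonoOn (left_mem_Icc.2 h.lt.le) (Ioc_subset_Icc_self ht) ht.1
    simp only [Real.rpow_add this]
    ring
  have hi3 := hi2.sub (hi1.const_mul ((α + 1) / (q + α + 1)))
  rw [← hq, hc]
  refine h.integral_cdf_rpow_sub_mul_nonneg (w := fun t => F t ^ α * f t)
    (m := fun t => (f t ^ (p + 1) / F t) ^ α) hq0 (div_pos hα1 (by linarith))
    ((div_lt_one (by linarith)).2 (by linarith)) (fun t ht => ?_) ?_ (fun t ht => ?_)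
    (hi3.congr hae) (fun t ht => ?_) hfr ?_
  · exact mul_nonneg (Real.rpow_nonneg (h.cdf_pos ht).le _) (h.pos t ht).le
  · intro s hs t ht hst
    -- The exponent `α ≤ 0` turns the decreasing quotient into an increasing factor.
    refine Real.rpow_le_rpow_of_nonpos ?_ (h.antitoneOn_rpow_div_cdf hp hs ht hst) hα0
    exact div_pos (Real.rpow_pos_of_pos (h.pos t ht) _) (h.cdf_pos ht)
  · exact Real.rpow_nonneg (div_nonneg (Real.rpow_nonneg (h.pos t ht).le _) (h.cdf_pos ht).le) _
  · have h1 := h.cdf_pos ht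
    have hf := h.pos t ht
    rw [Real.div_rpow (Real.rpow_nonneg hf.le _) h1.le, ← Real.rpow_mul hf.le,
      show (p + 1) * α = r - 1 by rw [hα]; field_simp, Real.rpow_sub_one hf.ne']
    have := (Real.rpow_pos_of_pos h1 α).ne'
    field_simp
  -- The constant is chosen so that this integral is exactly zero.
  · rw [← intervalIntegral.integral_congr_ae (Filter.Eventually.of_forall hae),
      intervalIntegral.integral_sub hi2 (hi1.const_mul _), intervalIntegral.integral_const_mul,
      he1, he2]
    have : q + α + 1 ≠ 0 := by linarith
    apply le_of_eq
    field_simp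
    simp

theorem le_cdf_zero (h : IsPConcaveDensity p a b f F) (hp : 0 < p) {c : ℝ} (hc : 0 ≤ c)
    (hF0 : 0 ≤ F 0) (hfm : Measurable f) (hf0 : ∀ t, 0 ≤ f t)
    (hfr : IntervalIntegrable (fun t => f t ^ r) volume a b)
    (hmean : ∫ t in a..b, t * f t ^ r = 0)
    (hint : 0 ≤ ∫ t in a..b, (F t ^ (p / (p + 1)) - c) * f t ^ r) :
    c ^ ((p + 1) / p) ≤ F 0 := by
  have hpos : 0 < ∫ t in a..b, f t ^ r :=
    intervalIntegral.intervalIntegral_pos_of_pos_on hfr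
      (fun t ht => Real.rpow_pos_of_pos (h.pos t ht) r) h.lt
  have h1 := (h.concaveOn_cdf_rpow hp).le_of_weighted_integral
    (h.continuousOn.rpow_const fun _ _ => Or.inr (by positivity)) h.lt.le (hfm.pow_const r)
    (fun t => Real.rpow_nonneg (hf0 t) r) hfr hpos hmean hint
  have h2 := Real.rpow_le_rpow hc h1 (z := (p + 1) / p) (by positivity)
  rwa [← Real.rpow_mul hF0, div_mul_div_cancel₀ (by linarith), div_self hp.ne',
    Real.rpow_one] at h2

end IsPConcaveDensity

/-! ### Fubini along the direction `u`. -/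

section Slicing

variable {n : ℕ} {u : EuclideanSpace ℝ (Fin n)}

theorem inner_smul_add_normalHyperplane (hu : ‖u‖ = 1) (t : ℝ) (y : normalHyperplane u) :
    inner ℝ (t • u + (y : EuclideanSpace ℝ (Fin n))) u = t := by
  have hy : inner ℝ (y : EuclideanSpace ℝ (Fin n)) u = 0 :=
    Submodule.mem_orthogonal_singleton_iff_inner_left.1 y.2
  rw [inner_add_left, hy, inner_smul_left, real_inner_self_eq_norm_sq, hu]
  simp

/-- Orthogonal decomposition along the line spanned by `u`, with that line identified isometrically
with `ℝ`. -/
theorem measurePreserving_smul_add_normalHyperplane (hu : ‖u‖ = 1) :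
    MeasurePreserving
      (fun z : ℝ × normalHyperplane u => z.1 • u + (z.2 : EuclideanSpace ℝ (Fin n))) := by
  have h1 : MeasurePreserving
      (Prod.map (LinearIsometryEquiv.toSpanUnitSingleton (𝕜 := ℝ) u hu)
        (id : normalHyperplane u → normalHyperplane u)) :=
    (LinearIsometryEquiv.measurePreserving _).prod (MeasurePreserving.id _)
  exact (Submodule.orthogonalDecomposition (Submodule.span ℝ {u})).symm.measurePreserving.comp
    ((WithLp.volume_preserving_toLp _ _).comp h1)

variable {K : Set (EuclideanSpace ℝ (Fin n))}

theorem abs_le_of_smul_add_mem (hu : ‖u‖ = 1) {R : ℝ} (hR : ∀ x ∈ K, ‖x‖ ≤ R) {t : ℝ}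
    {y : normalHyperplane u} (h : t • u + (y : EuclideanSpace ℝ (Fin n)) ∈ K) : |t| ≤ R := by
  have := abs_real_inner_le_norm (t • u + (y : EuclideanSpace ℝ (Fin n))) u
  rw [inner_smul_add_normalHyperplane hu, hu, mul_one] at this
  exact this.trans (hR _ h)

theorem section_subset_closedBall (hu : ‖u‖ = 1) {R : ℝ} (hR : ∀ x ∈ K, ‖x‖ ≤ R) (t : ℝ) :
    {y : normalHyperplane u | t • u + (y : EuclideanSpace ℝ (Fin n)) ∈ K} ⊆
      Metric.closedBall 0 (R + R) := by
  intro y hy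
  have h1 := abs_le_of_smul_add_mem hu hR hy
  have h2 := norm_sub_le (t • u + (y : EuclideanSpace ℝ (Fin n))) (t • u)
  rw [add_sub_cancel_left, norm_smul, hu, mul_one, Real.norm_eq_abs] at h2
  rw [mem_closedBall_zero_iff, Submodule.coe_norm]
  linarith [hR _ hy]

theorem sectionVolume_nonneg (t : ℝ) : 0 ≤ sectionVolume K u t := measureReal_nonneg

theorem sectionVolume_eq_zero_of_lt_abs (hu : ‖u‖ = 1) {R : ℝ} (hR : ∀ x ∈ K, ‖x‖ ≤ R) {t : ℝ}
    (ht : R < |t|) : sectionVolume K u t = 0 := by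
  have : {y : normalHyperplane u | t • u + (y : EuclideanSpace ℝ (Fin n)) ∈ K} = ∅ :=
    eq_empty_of_forall_notMem fun y hy => absurd (abs_le_of_smul_add_mem hu hR hy) (not_le.2 ht)
  rw [sectionVolume, this, measureReal_empty]

theorem sectionVolume_le (hu : ‖u‖ = 1) {R : ℝ} (hR : ∀ x ∈ K, ‖x‖ ≤ R) (t : ℝ) :
    sectionVolume K u t ≤
      (volume : Measure (normalHyperplane u)).real (Metric.closedBall 0 (R + R)) :=
  measureReal_mono (section_subset_closedBall hu hR t) measure_closedBall_lt_top.ne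

theorem measurableSet_smul_add_mem (hK : MeasurableSet K) :
    MeasurableSet {z : ℝ × normalHyperplane u |
      z.1 • u + (z.2 : EuclideanSpace ℝ (Fin n)) ∈ K} := by
  have : Continuous fun z : ℝ × normalHyperplane u =>
    z.1 • u + (z.2 : EuclideanSpace ℝ (Fin n)) := by fun_prop
  exact this.measurable hK

theorem measurable_sectionVolume (hK : MeasurableSet K) : Measurable (sectionVolume K u) :=
  (measurable_measure_prodMk_left (measurableSet_smul_add_mem hK)).ennreal_toReal

theorem integrable_sectionVolume (hu : ‖u‖ = 1) (hK : MeasurableSet K) {R : ℝ}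
    (hR : ∀ x ∈ K, ‖x‖ ≤ R) : Integrable (sectionVolume K u) := by
  have hsupp : Function.support (sectionVolume K u) ⊆ Icc (-R) R := by
    intro t ht
    rw [mem_Icc, ← abs_le]
    by_contra hcon
    exact ht (sectionVolume_eq_zero_of_lt_abs hu hR (not_le.1 hcon))
  rw [← integrableOn_iff_integrable_of_support_subset hsupp]
  refine Measure.integrableOn_of_bounded measure_Icc_lt_top.ne
    (measurable_sectionVolume hK).aestronglyMeasurable
    (M := (volume : Measure (normalHyperplane u)).real (Metric.closedBall 0 (R + R)))
    (Filter.Eventually.of_forall fun t => ?_)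
  rw [Real.norm_of_nonneg (sectionVolume_nonneg t)]
  exact sectionVolume_le hu hR t

theorem volume_real_inter_inner_mem (hu : ‖u‖ = 1) (hK : MeasurableSet K) {R : ℝ}
    (hR : ∀ x ∈ K, ‖x‖ ≤ R) {T : Set ℝ} (hT : MeasurableSet T) :
    volume.real (K ∩ {x | inner ℝ x u ∈ T}) = ∫ t in T, sectionVolume K u t := by
  have hmeas : MeasurableSet (K ∩ {x | inner ℝ x u ∈ T}) := by
    have : Measurable fun x : EuclideanSpace ℝ (Fin n) => inner ℝ x u := by fun_prop
    exact hK.inter (this hT)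
  have hpre : (fun z : ℝ × normalHyperplane u => z.1 • u + (z.2 : EuclideanSpace ℝ (Fin n))) ⁻¹'
      (K ∩ {x | inner ℝ x u ∈ T}) =
      {z : ℝ × normalHyperplane u | z.1 • u + (z.2 : EuclideanSpace ℝ (Fin n)) ∈ K} ∩
        Prod.fst ⁻¹' T := by
    ext z
    simp only [mem_preimage, mem_inter_iff, mem_ofPred_eq, inner_smul_add_normalHyperplane hu]
  rw [measureReal_def,
    ← (measurePreserving_smul_add_normalHyperplane hu).measure_preimage hmeas.nullMeasurableSet,
    hpre, Measure.volume_eq_prod,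
    Measure.prod_apply ((measurableSet_smul_add_mem hK).inter (measurable_fst hT)),
    integral_eq_lintegral_of_nonneg_ae (Filter.Eventually.of_forall sectionVolume_nonneg)
      (measurable_sectionVolume hK).aestronglyMeasurable, ← lintegral_indicator hT]
  congr 1
  refine lintegral_congr fun t => ?_
  by_cases ht : t ∈ T
  · rw [indicator_of_mem ht, sectionVolume, measureReal_def, ENNReal.ofReal_toReal]
    · congr 1
      ext y
      simp [ht]
    · exact ((measure_mono (section_subset_closedBall hu hR t)).trans_lt
        measure_closedBall_lt_top).ne
  · rw [indicator_of_notMem ht]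
    have : Prod.mk t ⁻¹' ({z : ℝ × normalHyperplane u |
        z.1 • u + (z.2 : EuclideanSpace ℝ (Fin n)) ∈ K} ∩ Prod.fst ⁻¹' T) = ∅ := by
      ext y
      simp [ht]
    rw [this, measure_empty]

end Slicing

/-! ### From a `p`-concave function to a density on an interval. -/

namespace IsPConcave

variable {p : ℝ} {f : ℝ → ℝ}

theorem ordConnected_support (h : IsPConcave p f) :
    OrdConnected {t | 0 < f t} := by
  refine Convex.ordConnected (convex_iff_forall_pos.2 fun x hx y hy s t hs ht hst => ?_)
  have h1 := h x y (mul_pos hx hy) t ht (by linarith)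
  rw [show 1 - t = s by linarith] at h1
  refine lt_of_lt_of_le (Real.rpow_pos_of_pos ?_ _) h1
  have := Real.rpow_pos_of_pos (show 0 < f x from hx) p
  have := Real.rpow_pos_of_pos (show 0 < f y from hy) p
  positivity

theorem concaveOn_rpow (h : IsPConcave p f) (hp : 0 < p) (hf0 : ∀ t, 0 ≤ f t) {D : Set ℝ}
    (hD : Convex ℝ D) (hpos : ∀ t ∈ D, 0 < f t) : ConcaveOn ℝ D fun t => f t ^ p := by
  refine concaveOn_iff_forall_pos.2 ⟨hD, fun x hx y hy s t hs ht hst => ?_⟩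
  have h1 := h x y (mul_pos (hpos x hx) (hpos y hy)) t ht (by linarith)
  rw [show 1 - t = s by linarith] at h1
  have h2 : 0 ≤ s * f x ^ p + t * f y ^ p := by
    have := Real.rpow_nonneg (hf0 x) p
    have := Real.rpow_nonneg (hf0 y) p
    positivity
  have h3 := Real.rpow_le_rpow (Real.rpow_nonneg h2 _) h1 hp.le
  rwa [← Real.rpow_mul h2, one_div_mul_cancel hp.ne', Real.rpow_one] at h3

/-- The endpoints of the support of a `p`-concave function with positive integral. -/
theorem exists_support (h : IsPConcave p f) (hf0 : ∀ t, 0 ≤ f t) {R : ℝ}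
    (hR : ∀ t, R < |t| → f t = 0) (hint : 0 < ∫ t, f t) :
    ∃ a b, a < b ∧ (∀ t ∈ Ioo a b, 0 < f t) ∧ ∀ t, t ∉ Icc a b → f t = 0 := by
  obtain ⟨S, hS⟩ : ∃ S, S = {t | 0 < f t} := ⟨_, rfl⟩
  have hconn : OrdConnected S := hS ▸ h.ordConnected_support
  have hmem : ∀ t, f t ≠ 0 → t ∈ S := fun t ht => hS ▸ (hf0 t).lt_of_ne' ht
  have hSR : S ⊆ Icc (-R) R := by
    intro t ht
    rw [mem_Icc, ← abs_le]
    by_contra hcon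
    rw [hS] at ht
    exact ht.ne' (hR t (not_le.1 hcon))
  have hbb : BddBelow S := bddBelow_Icc.mono hSR
  have hba : BddAbove S := bddAbove_Icc.mono hSR
  have hne : S.Nonempty := by
    by_contra hcon
    rw [not_nonempty_iff_eq_empty] at hcon
    have : ∀ t, f t = 0 := fun t => by
      by_contra ht
      exact absurd (hmem t ht) (hcon ▸ notMem_empty t)
    simp [this] at hint
  have hsub : S ⊆ Icc (sInf S) (sSup S) := fun t ht => ⟨csInf_le hbb ht, le_csSup hba ht⟩
  have hzero : ∀ t, t ∉ Icc (sInf S) (sSup S) → f t = 0 := fun t ht => by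
    by_contra hcon
    exact ht (hsub (hmem t hcon))
  refine ⟨sInf S, sSup S, ?_, fun t ht => ?_, hzero⟩
  · by_contra hcon
    have hae : f =ᵐ[volume] 0 := by
      filter_upwards [compl_mem_ae_iff.2 (measure_singleton (sInf S))] with t ht
      refine hzero t fun htI => ht ?_
      exact le_antisymm (htI.2.trans (not_lt.1 hcon)) htI.1
    rw [integral_congr_ae hae] at hint
    simp at hint
  · obtain ⟨x, hx, hxt⟩ := exists_lt_of_csInf_lt hne ht.1
    obtain ⟨y, hy, hty⟩ := exists_lt_of_lt_csSup hne ht.2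
    have : t ∈ S := hconn.out hx hy ⟨hxt.le, hty.le⟩
    rwa [hS] at this

theorem isPConcaveDensity (h : IsPConcave p f) (hp : 0 < p) (hf0 : ∀ t, 0 ≤ f t)
    (hfi : Integrable f) (hint : 0 < ∫ t, f t) {a b : ℝ} (hab : a < b)
    (hpos : ∀ t ∈ Ioo a b, 0 < f t) (hzero : ∀ t, t ∉ Icc a b → f t = 0) :
    IsPConcaveDensity p a b (fun t => f t / ∫ s, f s)
      (fun t => (∫ s in Iic t, f s) / ∫ s, f s) := by
  have hconc := h.concaveOn_rpow hp hf0 (convex_Ioo a b) hpos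
  have hleft : ∫ s in Iic a, f s = 0 := by
    -- The value `f a` may be positive, so the endpoint is removed first.
    rw [integral_Iic_eq_integral_Iio]
    exact setIntegral_eq_zero_of_forall_eq_zero fun t ht => hzero t fun hI => not_lt.2 hI.1 ht
  have hright : ∫ s in Iic b, f s = ∫ s, f s :=
    setIntegral_eq_integral_of_forall_compl_eq_zero fun t ht => hzero t fun hI => ht hI.2
  have heq : (fun t => (∫ s in Iic t, f s)) = fun t => ∫ s in a..t, f s := by
    funext t
    rw [← intervalIntegral.integral_Iic_sub_Iic hfi.integrableOn hfi.integrableOn, hleft, sub_zero]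
  refine ⟨hab, ?_, fun t ht => ?_, fun t ht => div_pos (hpos t ht) hint, ?_, ?_, ?_⟩
  · refine ContinuousOn.div_const ?_ _
    rw [heq]
    exact (intervalIntegral.continuous_primitive (fun _ _ => hfi.intervalIntegrable) a).continuousOn
  · refine HasDerivAt.div_const ?_ _
    rw [heq]
    -- Concavity of `f ^ p` on an open interval gives continuity of `f`, as required to
    -- differentiate the primitive.
    have hcp : ContinuousAt (fun t => f t ^ p) t :=
      (hconc.continuousOn isOpen_Ioo).continuousAt (isOpen_Ioo.mem_nhds ht)
    have hc : ContinuousAt f t := by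
      have := hcp.rpow_const (p := p⁻¹) (Or.inr (by positivity))
      simpa only [Real.rpow_rpow_inv (hf0 _) hp.ne'] using this
    exact intervalIntegral.integral_hasDerivAt_right hfi.intervalIntegrable
      (hfi.aestronglyMeasurable.stronglyMeasurableAtFilter) hc
  · have := hconc.smul (Real.rpow_nonneg hint.le (-p))
    convert! this using 2 with t
    rw [Real.div_rpow (hf0 _) hint.le, Real.rpow_neg hint.le, smul_eq_mul, div_eq_inv_mul]
  · simp only [hleft, zero_div]
  · simp only [hright, div_self hint.ne']

end IsPConcave

/-! ### Application to the section function. -/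

theorem theoremt {n : ℕ} (K : Set (EuclideanSpace ℝ (Fin n))) (hK : IsCompact K)
    (hKint : (interior K).Nonempty) (u : EuclideanSpace ℝ (Fin n)) (hu : ‖u‖ = 1)
    (r : ℝ) (hr : 0 ≤ r) (hcentroid : poweredCentroid K u r • u = 0)
    (p : ℝ) (hp : 0 < p) (hf : IsPConcave p (sectionVolume K u)) :
    (1 ≤ r → ((p + 1) / (2 * p + r)) ^ ((p + 1) / p) ≤
      volume.real (lowerPart K u) / volume.real K) ∧
    (r ≤ 1 → ((p + r) / (2 * p + r)) ^ ((p + 1) / p) ≤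
      volume.real (lowerPart K u) / volume.real K) := by
  obtain ⟨R, hR⟩ := hK.isBounded.exists_norm_le
  have hKm := hK.measurableSet
  have hf0 : ∀ t, 0 ≤ sectionVolume K u t := sectionVolume_nonneg
  have hfm : Measurable (sectionVolume K u) := measurable_sectionVolume hKm
  have hfi := integrable_sectionVolume hu hKm hR
  have hvol : volume.real K = ∫ t, sectionVolume K u t := by
    simpa using volume_real_inter_inner_mem hu hKm hR MeasurableSet.univ
  have hlow : volume.real (lowerPart K u) = ∫ t in Iic 0, sectionVolume K u t :=
    volume_real_inter_inner_mem hu hKm hR measurableSet_Iic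
  have hV : 0 < ∫ t, sectionVolume K u t := by
    rw [← hvol]
    exact ENNReal.toReal_pos (Measure.measure_pos_of_nonempty_interior _ hKint).ne' hK.measure_lt_top.ne
  obtain ⟨a, b, hab, hpos, hzero⟩ := hf.exists_support hf0
    (fun t => sectionVolume_eq_zero_of_lt_abs hu hR) hV
  have hd := hf.isPConcaveDensity hp hf0 hfi hV hab hpos hzero
  -- For `r = 0` the convention `0 ^ 0 = 1` makes the weight `1` everywhere, so the domain of
  -- integration has to be pinned down.
  have hsupp : tsupport (sectionVolume K u) = Icc a b := by
    refine Subset.antisymm (closure_minimal (fun t ht => ?_) isClosed_Icc) ?_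
    · by_contra hcon
      exact ht (hzero t hcon)
    · rw [← closure_Ioo hab.ne]
      exact closure_mono fun t ht => (hpos t ht).ne'
  have hfr : IntervalIntegrable (fun t => sectionVolume K u t ^ r) volume a b := by
    rw [intervalIntegrable_iff_integrableOn_Ioc_of_le hab.le]
    refine Measure.integrableOn_of_bounded measure_Ioc_lt_top.ne
      (hfm.pow_const r).aestronglyMeasurable
      (M := (volume : Measure (normalHyperplane u)).real (Metric.closedBall 0 (R + R)) ^ r)
      (Filter.Eventually.of_forall fun t => ?_)
    rw [Real.norm_of_nonneg (Real.rpow_nonneg (hf0 t) r)]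
    exact Real.rpow_le_rpow (hf0 t) (sectionVolume_le hu hR t) hr
  have hmass : 0 < ∫ t in a..b, sectionVolume K u t ^ r :=
    intervalIntegral.intervalIntegral_pos_of_pos_on hfr
      (fun t ht => Real.rpow_pos_of_pos (hpos t ht) r) hab
  have hmean : ∫ t in a..b, t * sectionVolume K u t ^ r = 0 := by
    have hu0 : u ≠ 0 := by rintro rfl; simp at hu
    have := (smul_eq_zero.1 hcentroid).resolve_right hu0
    rw [poweredCentroid, hsupp, integral_Icc_eq_integral_Ioc, integral_Icc_eq_integral_Ioc,
      ← intervalIntegral.integral_of_le hab.le, ← intervalIntegral.integral_of_le hab.le] at this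
    exact (div_eq_zero_iff.1 this).resolve_right hmass.ne'
  -- Normalising the density multiplies the weight by a constant and keeps its barycentre at `0`.
  have hscale : ∀ t, (sectionVolume K u t / ∫ s, sectionVolume K u s) ^ r =
      sectionVolume K u t ^ r * ((∫ s, sectionVolume K u s) ^ r)⁻¹ := fun t => by
    rw [Real.div_rpow (hf0 t) hV.le, div_eq_mul_inv]
  have hdr : IntervalIntegrable
      (fun t => (sectionVolume K u t / ∫ s, sectionVolume K u s) ^ r) volume a b := by
    simp only [hscale]
    exact hfr.mul_const _
  have hdmean :
      ∫ t in a..b, t * (sectionVolume K u t / ∫ s, sectionVolume K u s) ^ r = 0 := by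
    simp only [hscale, ← mul_assoc]
    rw [intervalIntegral.integral_mul_const, hmean, zero_mul]
  have hF0 : 0 ≤ (∫ s in Iic 0, sectionVolume K u s) / ∫ s, sectionVolume K u s :=
    div_nonneg (integral_nonneg hf0) hV.le
  rw [hlow, hvol]
  refine ⟨fun hr1 => ?_, fun hr1 => ?_⟩
  · exact hd.le_cdf_zero hp (by positivity) hF0 (hfm.div_const _)
      (fun t => div_nonneg (hf0 t) hV.le) hdr hdmean (hd.integral_nonneg_of_one_le hp hr1 hdr)
  · exact hd.le_cdf_zero hp (by positivity) hF0 (hfm.div_const _)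
      (fun t => div_nonneg (hf0 t) hV.le) hdr hdmean (hd.integral_nonneg_of_le_one hp hr hr1 hdr)
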